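/- **Setting.** Let $k\ge 2$ be the number of labels, $[k]=\{1,\dots,k\}$. In each round $t=1,\dots,T$ an adversary picks, possibly at random and adaptively to what it has observed so far, a labeled example $(x_t,y_t)\in\mathcal X\times[k]$ and reveals $x_t$; $y_t$ is revealed at the end of the round. An online learner receives $x_t$ and a cost matrix $C_t\in\mathbb R^{k\times k}$, predicts (possibly at random, depending on its own past) a label $l_t\in[k]$, and is then shown $y_t$ and a weight $w_t$. A cost matrix is admissible if $C[l,l]=0$, $C[l,r]\ge 0$ and every row has $\ell_1$-norm $1$ or is zero. The learner and the adversary satisfy the *online weak learning condition* with parameters $\delta,\gamma\in(0,1)$, $S>0$ if for every $T$ and every adaptive choice of admissible cost matrices $C_t$ (chosen before $y_t$ is known) and weights $w_t\in[0,1]$ (chosen independently of the learner's fresh randomness of round $t$, possibly knowing $y_t$), with probability at least $1-\delta$, $$\sum_{t=1}^T w_tC_t[y_t,l_t]\le \frac{1-\gamma}{k}\sum_{t=1}^T w_t+S .$$ **Algorithm.** Let $u^r_\gamma$ be the distribution on $[k]$ with $u^r_\gamma(l)=\frac{1-\gamma}{k}+\gamma\mathbf 1(l=r)$, and define potentials by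 $\phi^r_0(s)=\mathbf 1(\max_{l\ne r}s[l]\ge s[r])$, $\phi^r_{m+1}(s)=\mathbb E_{l\sim u^r_\gamma}\,\phi^r_m(s+e_l)$. OnlineMBBM uses $N$ learners. In round $t$ it asks them one after another; with $s^{i-1}_t$ the vote counts of the first $i-1$ learners, learner $i$ gets the cost matrix with entries $\big(\phi^r_{N-i}(s^{i-1}_t+e_l)-\phi^r_{N-i}(s^{i-1}_t+e_r)\big)/\mathbf w^{i,r}_t$, where $\mathbf w^{i,r}_t=\sum_{l}\big(\phi^{r}_{N-i}(s^{i-1}_t+e_l)-\phi^{r}_{N-i}(s^{i-1}_t+e_{r})\big)$ (a row with $\mathbf w^{i,r}_t=0$ is zero). The final prediction $\hat y_t$ is a label with the most votes (ties broken arbitrarily). After $y_t$ is revealed, learner $i$ gets $y_t$ and the weight $\mathbf w^{i,y_t}_t/w^{i*}$, where $w^{i*}=ck^{5/2}/\sqrt{N-i}$ for $i<N$ and $w^{N*}=k$, for a universal constant $c>0$. **Result.** There are universal constants $c,C,c_1,c_2>0$ such that, for all $k\ge2$ and $0<\gamma<\frac12$, the following hold. 1. For all $\delta\in(0,1)$,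 $S>0$, $N$ and $T$: if each of the $N$ learners satisfies, together with the adversary, the online weak learning condition with parameters $\delta,\gamma,S$, then with probability at least $1-N\delta$ OnlineMBBM (with the constant $c$) satisfies $$\sum_{t=1}^T\mathbf 1(y_t\ne\hat y_t)\le (k-1)e^{-\gamma^2N/2}\,T+C\,k^{5/2}\sqrt N\,S .$$ 2. Let $\varepsilon\in(0,1)$. There are integers $N$ with $\frac{2}{\gamma^2}\ln\frac k\varepsilon\le N\le\frac{3}{\gamma^2}\ln\frac k\varepsilon$. For every such $N$, and all $\delta\in(0,1)$, $S>0$, $T$, learners and adversary as in 1, with probability at least $1-N\delta$, $$\sum_{t=1}^T\mathbf 1(y_t\ne\hat y_t)\le \varepsilon T+C\,k^{5/2}\sqrt N\,S,$$ and the excess loss bound satisfies $c_1\frac{k^{5/2}}{\gamma}S\sqrt{\ln\frac k\varepsilon}\le C\,k^{5/2}\sqrt N\,S\le c_2\frac{k^{5/2}}{\gamma}S\sqrt{\ln\frac k\varepsilon}$. -/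

import Mathlib

open MeasureTheory ProbabilityTheory

universe u

namespace OnlineBoosting

/-! ### Cost matrices, the edge distribution, and the potential of the 0-1 loss

Labels are `Fin k`. -/

/-- A `k × k` cost matrix: `C r l` is the cost of predicting `l` when the true label is `r`. -/
abbrev CostMatrix (k : ℕ) : Type := Fin k → Fin k → ℝ

/-- Admissible cost matrices: zero diagonal, nonnegative entries, and every row of `ℓ¹`-norm `1`,
where a row that vanishes identically (and so cannot be normalized) is allowed too. -/
def IsAdmissibleCost {k : ℕ} (C : CostMatrix k) : Prop :=
  ∀ r, C r r = 0 ∧ (∀ l, 0 ≤ C r l) ∧ (∑ l, C r l = 1 ∨ ∀ l, C r l = 0)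

/-- The distribution `u^r_γ` on labels: uniform, with `γ` more weight on `r`. -/
noncomputable def edgeDist {k : ℕ} (γ : ℝ) (r l : Fin k) : ℝ :=
  (1 - γ) / k + if l = r then γ else 0

/-- The multiclass 0-1 loss of a vote count `s` when the true label is `r`:
it is `1` when some other label has at least as many votes as `r`. -/
def zeroOneLoss {k : ℕ} (r : Fin k) (s : Fin k → ℕ) : ℝ :=
  if ∃ l, l ≠ r ∧ s r ≤ s l then 1 else 0

/-- The potential `Φ^r_m(s)` of the 0-1 loss when `m` learners remain. -/
noncomputable def potential {k : ℕ} (γ : ℝ) (r : Fin k) : ℕ → (Fin k → ℕ) → ℝ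
  | 0, s => zeroOneLoss r s
  | m + 1, s => ∑ l, edgeDist γ r l * potential γ r m (s + Pi.single l 1)

/-! ### Learners and adversaries -/

/-- What a learner remembers of a finished round: the instance, the cost matrix, its own
prediction, the true label and the importance weight. -/
abbrev LearnerRecord (X : Type u) (k : ℕ) : Type u :=
  X × CostMatrix k × Fin k × Fin k × ℝ

/-- A (randomized) online learner: from its finished rounds, the current instance and the current
cost matrix it draws a label. The true label and the weight of the round are shown to it only
afterwards. -/
structure OnlineLearner (X : Type u) [MeasurableSpace X] (k : ℕ) where
  predict : ∀ t : ℕ, Kernel ((Fin t → LearnerRecord X k) × X × CostMatrix k) (Fin k)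
  markov : ∀ t, IsMarkovKernel (predict t)

/-- A (randomized, adaptive) adversary: from its past examples and what it has observed at the end
of each past round (an element of `O`, for example the predictions of the booster) it draws
the next labeled example. -/
structure Adversary (X O : Type u) [MeasurableSpace X] [MeasurableSpace O] (k : ℕ) where
  pick : ∀ t : ℕ, Kernel (Fin t → X × Fin k × O) (X × Fin k)
  markov : ∀ t, IsMarkovKernel (pick t)

/-! ### The online weak learning condition -/

/-- `T` rounds between one learner, the adversary, and an arbitrary adaptive choice of weights and
cost matrices. In round `t`, given the past, the adversary draws `(x t, y t)`; the cost matrix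
`C t` is chosen, possibly at random, without knowing `y t`; the weight `w t` is chosen, possibly
knowing `y t`; the learner draws `l t` from its own information. At the end of the round the
adversary makes an observation `o t`. -/
structure WeakLearningPlay {X O : Type u} [MeasurableSpace X] [MeasurableSpace O] {k : ℕ}
    (adv : Adversary X O k) (wl : OnlineLearner X k) (T : ℕ)
    {Ω : Type u} [mΩ : MeasurableSpace Ω] (μ : Measure Ω) where
  /-- everything that happened before round `t` -/
  past : Filtration ℕ mΩ
  /-- what is known when `C t` is chosen -/
  pre : ℕ → MeasurableSpace Ω
  /-- everything up to the moment before the learner draws `l t` -/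
  full : ℕ → MeasurableSpace Ω
  x : ℕ → Ω → X
  y : ℕ → Ω → Fin k
  C : ℕ → Ω → CostMatrix k
  w : ℕ → Ω → ℝ
  l : ℕ → Ω → Fin k
  o : ℕ → Ω → O
  past_le_pre : ∀ t < T, past t ≤ pre t
  pre_le_full : ∀ t < T, pre t ≤ full t
  full_le_past : ∀ t < T, full t ≤ past (t + 1)
  measurable_x : ∀ t < T, Measurable[pre t] (x t)
  measurable_C : ∀ t < T, Measurable[pre t] (C t)
  measurable_y : ∀ t < T, Measurable[full t] (y t)
  measurable_w : ∀ t < T, Measurable[full t] (w t)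
  measurable_l : ∀ t < T, Measurable[past (t + 1)] (l t)
  measurable_o : ∀ t < T, Measurable[past (t + 1)] (o t)
  admissible_C : ∀ t < T, ∀ ω, IsAdmissibleCost (C t ω)
  mem_w : ∀ t < T, ∀ ω, w t ω ∈ Set.Icc (0 : ℝ) 1
  /-- given the past, `(x t, y t)` has the law prescribed by the adversary -/
  example_law : ∀ t < T, ∀ B : Set (X × Fin k), MeasurableSet B →
    μ[((fun ω => (x t ω, y t ω)) ⁻¹' B).indicator (fun _ => (1 : ℝ)) | past t]
      =ᵐ[μ] fun ω => (adv.pick t (fun s : Fin t => (x s ω, y s ω, o s ω))).real B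
  /-- what is known when `C t` is chosen tells no more about `y t` than the past and `x t` do -/
  no_leak : ∀ t < T, ∀ b : Fin k,
    μ[(y t ⁻¹' {b}).indicator (fun _ => (1 : ℝ)) | pre t]
      =ᵐ[μ] μ[(y t ⁻¹' {b}).indicator (fun _ => (1 : ℝ)) |
        (past t : MeasurableSpace Ω) ⊔ MeasurableSpace.comap (x t) inferInstance]
  /-- given everything before, `l t` has the law prescribed by the learner -/
  prediction_law : ∀ t < T, ∀ a : Fin k,
    μ[(l t ⁻¹' {a}).indicator (fun _ => (1 : ℝ)) | full t]
      =ᵐ[μ] fun ω => (wl.predict t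
        (fun s : Fin t => (x s ω, C s ω, l s ω, y s ω, w s ω), x t ω, C t ω)).real {a}

/-- The online multiclass weak learning condition with parameters `δ`, `γ` (edge) and `S` (excess
loss), for a pair of a learner and an adversary. -/
def WeakLearningCondition {X O : Type u} [MeasurableSpace X] [MeasurableSpace O] {k : ℕ}
    (adv : Adversary X O k) (wl : OnlineLearner X k) (δ γ S : ℝ) : Prop :=
  ∀ (T : ℕ) (Ω : Type u) [MeasurableSpace Ω] (μ : Measure Ω) [IsProbabilityMeasure μ]
    (P : WeakLearningPlay adv wl T μ),
    1 - δ ≤ μ.real {ω | ∑ t ∈ Finset.range T, P.w t ω * P.C t ω (P.y t ω) (P.l t ω)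
      ≤ (1 - γ) / k * ∑ t ∈ Finset.range T, P.w t ω + S}

/-! ### OnlineMBBM

The learners are numbered `0, …, N - 1`, so that `N - (i + 1)` learners remain after learner `i`. -/

/-- The votes of the learners `j < i`. -/
def votes {k N : ℕ} (p : Fin N → Fin k) (i : ℕ) : Fin k → ℕ :=
  fun a => (Finset.univ.filter (fun j : Fin N => (j : ℕ) < i ∧ p j = a)).card

/-- The unnormalized weight of an example with label `r`, at the current votes `s`, when `m`
learners remain after the present one. -/
noncomputable def rawWeight {k : ℕ} (γ : ℝ) (m : ℕ) (s : Fin k → ℕ) (r : Fin k) : ℝ :=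
  ∑ l, (potential γ r m (s + Pi.single l 1) - potential γ r m (s + Pi.single r 1))

/-- The normalized cost matrix. A row that cannot be normalized is zero (division by zero). -/
noncomputable def mbbmCost {k : ℕ} (γ : ℝ) (m : ℕ) (s : Fin k → ℕ) : CostMatrix k :=
  fun r l => (potential γ r m (s + Pi.single l 1) - potential γ r m (s + Pi.single r 1))
    / rawWeight γ m s r

/-- The estimate, fixed in advance, of the largest unnormalized weight when `m` learners remain:
`c k^{5/2} / √m`, and `k` for the last learner. -/
noncomputable def weightEstimate (c : ℝ) (k m : ℕ) : ℝ :=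
  if m = 0 then (k : ℝ) else c * (k : ℝ) ^ (5 / 2 : ℝ) / Real.sqrt m

/-- `T` rounds of OnlineMBBM with the learners `wl 0, …, wl (N - 1)` against the adversary. In round
`t` the adversary draws `(x t, y t)` given the past; the learners draw their predictions
`l t 0, …, l t (N - 1)` one after another, each from its own information; the booster predicts a
label `yhat t` with the most votes (ties are broken arbitrarily); at the end of the round each
learner is shown the true label and its weight, and the adversary makes an arbitrary
observation `o t`. -/
structure MBBMRun {X O : Type u} [MeasurableSpace X] [MeasurableSpace O] {k N : ℕ}
    (c γ : ℝ) (adv : Adversary X O k) (wl : Fin N → OnlineLearner X k) (T : ℕ)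
    {Ω : Type u} [mΩ : MeasurableSpace Ω] (μ : Measure Ω) where
  /-- everything that happened before round `t` -/
  past : Filtration ℕ mΩ
  x : ℕ → Ω → X
  y : ℕ → Ω → Fin k
  l : ℕ → Fin N → Ω → Fin k
  yhat : ℕ → Ω → Fin k
  o : ℕ → Ω → O
  /-- the cost matrix that the booster sends to learner `i` in round `t` -/
  C : ℕ → Fin N → Ω → CostMatrix k
  /-- the weight that the booster sends to learner `i` at the end of round `t` -/
  w : ℕ → Fin N → Ω → ℝ
  C_eq : ∀ t < T, ∀ i ω,
    C t i ω = mbbmCost γ (N - (i + 1)) (votes (fun j => l t j ω) i)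
  w_eq : ∀ t < T, ∀ i ω,
    w t i ω = rawWeight γ (N - (i + 1)) (votes (fun j => l t j ω) i) (y t ω)
      / weightEstimate c k (N - (i + 1))
  measurable_x : ∀ t < T, Measurable[past (t + 1)] (x t)
  measurable_y : ∀ t < T, Measurable[past (t + 1)] (y t)
  measurable_l : ∀ t < T, ∀ i, Measurable[past (t + 1)] (l t i)
  measurable_o : ∀ t < T, Measurable[past (t + 1)] (o t)
  measurable_yhat : ∀ t < T, Measurable (yhat t)
  /-- the booster predicts by simple majority vote -/
  majority : ∀ t < T, ∀ ω a,
    votes (fun j => l t j ω) N a ≤ votes (fun j => l t j ω) N (yhat t ω)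
  /-- given the past, `(x t, y t)` has the law prescribed by the adversary -/
  example_law : ∀ t < T, ∀ B : Set (X × Fin k), MeasurableSet B →
    μ[((fun ω => (x t ω, y t ω)) ⁻¹' B).indicator (fun _ => (1 : ℝ)) | past t]
      =ᵐ[μ] fun ω => (adv.pick t (fun s : Fin t => (x s ω, y s ω, o s ω))).real B
  /-- given the past, the example and the predictions of the earlier learners, `l t i` has the law
  prescribed by learner `i` -/
  prediction_law : ∀ t < T, ∀ i, ∀ a : Fin k,
    μ[(l t i ⁻¹' {a}).indicator (fun _ => (1 : ℝ)) |
        (past t : MeasurableSpace Ω) ⊔ MeasurableSpace.comap (x t) inferInstance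
          ⊔ MeasurableSpace.comap (y t) inferInstance
          ⊔ ⨆ j : {j : Fin N // j < i}, MeasurableSpace.comap (l t j) inferInstance]
      =ᵐ[μ] fun ω => ((wl i).predict t
        (fun s : Fin t => (x s ω, C s i ω, l s i ω, y s ω, w s i ω), x t ω, C t i ω)).real {a}

/-- The number of mistakes of the booster. -/
noncomputable def MBBMRun.mistakes {X O : Type u} [MeasurableSpace X] [MeasurableSpace O]
    {k N : ℕ} {c γ : ℝ} {adv : Adversary X O k} {wl : Fin N → OnlineLearner X k} {T : ℕ}
    {Ω : Type u} [MeasurableSpace Ω] {μ : Measure Ω} (R : MBBMRun c γ adv wl T μ) (ω : Ω) : ℝ :=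
  ∑ t ∈ Finset.range T, if R.y t ω ≠ R.yhat t ω then 1 else 0

/-- Whenever each of the `N` learners satisfies, together with the adversary, the online weak
learning condition with parameters `δ`, `γ`, `S`, then for every `T`, OnlineMBBM makes at most
`bound T` mistakes in `T` rounds, with probability at least `1 - N δ`. -/
def MBBMGuarantee (c : ℝ) (k N : ℕ) (δ γ S : ℝ) (bound : ℕ → ℝ) : Prop :=
  ∀ (X O : Type u) [MeasurableSpace X] [MeasurableSpace O]
    (adv : Adversary X O k) (wl : Fin N → OnlineLearner X k),
    (∀ i, WeakLearningCondition adv (wl i) δ γ S) →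
    ∀ (T : ℕ) (Ω : Type u) [MeasurableSpace Ω] (μ : Measure Ω) [IsProbabilityMeasure μ]
      (R : MBBMRun c γ adv wl T μ),
      1 - N * δ ≤ μ.real {ω | R.mistakes ω ≤ bound T}

end OnlineBoosting

/-! The potential $\Phi^r_m(s)$ is the probability that $r$ fails to win outright after $m$ more
independent votes from $u^r_\gamma$. Replacing one such vote by an actual vote $l$ changes it by
exactly the raw weight times (cost of $l$ minus $(1-\gamma)/k$). Telescoping over the learners
writes the final loss as $\Phi^r_N(0)$ plus weighted regrets (`potential_votes_eq`). Summed over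
rounds, the regrets of learner $i$ are at most $w^{i*}S$ on the event of its weak learning
condition; a union bound makes all $N$ events hold together.

Two estimates remain, both about the random walk $s[l]-s[r]$ on $\mathbb Z$. A Chernoff bound gives
$\Phi^r_N(0)\le(k-1)e^{-\gamma^2N/2}$ (`potential_zero_le`). Anticoncentration gives raw weights of
order $k^{5/2}/\sqrt m$ (`rawWeight_le_weightEstimate`), so the normalized weights lie in $[0,1]$
and $\sum_i w^{i*}$ is of order $k^{5/2}\sqrt N$.

Applying the condition to learner $i$ also requires that its cost matrix, a function of the earlier
votes, reveal nothing about $y_t$ beyond the past and $x_t$. This holds because every earlier vote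
is drawn without access to $y_t$ (`condExp_sup_iSup_comap_eq`). -/

namespace OnlineBoosting

/-! ### Expectations over independent votes -/

/-- The expectation of `g` at the votes `s` after `m` more independent votes drawn from
`edgeDist γ r`. -/
noncomputable def voteExp {k : ℕ} (γ : ℝ) (r : Fin k) :
    ℕ → ((Fin k → ℕ) → ℝ) → (Fin k → ℕ) → ℝ
  | 0, g, s => g s
  | m + 1, g, s => ∑ l, edgeDist γ r l * voteExp γ r m g (s + Pi.single l 1)

section voteExp
variable {k : ℕ} {γ : ℝ} {r : Fin k}

lemma edgeDist_nonneg (h0 : 0 ≤ γ) (h1 : γ ≤ 1) (l : Fin k) : 0 ≤ edgeDist γ r l := by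
  unfold edgeDist
  have : 0 ≤ (1 - γ) / k := div_nonneg (by linarith) (Nat.cast_nonneg k)
  split_ifs <;> linarith

lemma sum_edgeDist_mul (f : Fin k → ℝ) :
    ∑ l, edgeDist γ r l * f l = (1 - γ) / k * ∑ l, f l + γ * f r := by
  simp [edgeDist, add_mul, Finset.sum_add_distrib, Finset.mul_sum]

lemma sum_edgeDist : ∑ l, edgeDist γ r l = 1 := by
  have h := sum_edgeDist_mul (γ := γ) (r := r) (fun _ => 1)
  have hk : (k : ℝ) ≠ 0 := by
    have := r.pos
    positivity
  simp only [mul_one] at h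
  rw [h]
  simp
  field_simp
  ring

/-- Separating the expectation from the loss lets any pointwise bound on the loss pass to the
potential, by linearity and monotonicity. -/
lemma potential_eq_voteExp (m : ℕ) (s : Fin k → ℕ) :
    potential γ r m s = voteExp γ r m (zeroOneLoss r) s := by
  induction m generalizing s with
  | zero => rfl
  | succ m ih => simp [potential, voteExp, ih]

/-- The order of votes is irrelevant, so a fixed vote may be cast last. Comparing potentials at two
neighbouring counts then reduces to comparing losses pointwise. -/
lemma voteExp_add_right (m : ℕ) (g : (Fin k → ℕ) → ℝ) (s v : Fin k → ℕ) :
    voteExp γ r m g (s + v) = voteExp γ r m (fun s => g (s + v)) s := by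
  induction m generalizing s with
  | zero => rfl
  | succ m ih => simp [voteExp, ← ih, add_right_comm]

lemma voteExp_mono (h0 : 0 ≤ γ) (h1 : γ ≤ 1) {g h : (Fin k → ℕ) → ℝ} (hgh : ∀ s, g s ≤ h s)
    (m : ℕ) (s : Fin k → ℕ) : voteExp γ r m g s ≤ voteExp γ r m h s := by
  induction m generalizing s with
  | zero => exact hgh s
  | succ m ih =>
    exact Finset.sum_le_sum fun l _ => mul_le_mul_of_nonneg_left (ih _) (edgeDist_nonneg h0 h1 l)

lemma voteExp_const (a : ℝ) (m : ℕ) (s : Fin k → ℕ) : voteExp γ r m (fun _ => a) s = a := by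
  induction m generalizing s with
  | zero => rfl
  | succ m ih => simp [voteExp, ih, ← Finset.sum_mul, sum_edgeDist]

lemma voteExp_add (g h : (Fin k → ℕ) → ℝ) (m : ℕ) (s : Fin k → ℕ) :
    voteExp γ r m (fun s => g s + h s) s = voteExp γ r m g s + voteExp γ r m h s := by
  induction m generalizing s with
  | zero => rfl
  | succ m ih => simp [voteExp, ih, mul_add, Finset.sum_add_distrib]

lemma voteExp_sum {ι : Type*} (I : Finset ι) (g : ι → (Fin k → ℕ) → ℝ) (m : ℕ)
    (s : Fin k → ℕ) :
    voteExp γ r m (fun s => ∑ i ∈ I, g i s) s = ∑ i ∈ I, voteExp γ r m (g i) s := by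
  induction m generalizing s with
  | zero => rfl
  | succ m ih =>
    simp only [voteExp, ih, Finset.mul_sum]
    exact Finset.sum_comm

end voteExp

/-! ### The difference of two vote counts is a random walk on `ℤ` -/

/-- Translation of functions on `ℤ`. -/
def shift (n : ℤ) : Module.End ℝ (ℤ → ℝ) := LinearMap.funLeft ℝ ℝ (· + n)

@[simp] lemma shift_apply (n : ℤ) (h : ℤ → ℝ) (d : ℤ) : shift n h d = h (d + n) := rfl

lemma shift_mul (a b : ℤ) : shift a * shift b = shift (a + b) := by
  ext h d
  simp [add_assoc]

lemma shift_zero : shift 0 = 1 := by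
  ext h d
  simp

lemma shift_pow (a : ℤ) (n : ℕ) : shift a ^ n = shift (n * a) := by
  induction n with
  | zero => simp [shift_zero]
  | succ n ih => rw [pow_succ, ih, shift_mul]; congr 1; push_cast; ring

lemma shift_commute (a b : ℤ) : Commute (shift a) (shift b) := by
  simp [Commute, SemiconjBy, shift_mul, add_comm]

/-- The transition operator of the walk that moves up with probability `p` and down with
probability `p + γ`. -/
noncomputable def walk (p γ : ℝ) : Module.End ℝ (ℤ → ℝ) :=
  p • (shift 1 + shift (-1)) + (γ • shift (-1) + (1 - 2 * p - γ) • shift 0)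

lemma walk_apply (p γ : ℝ) (h : ℤ → ℝ) (d : ℤ) :
    walk p γ h d = p * h (d + 1) + (p + γ) * h (d - 1) + (1 - 2 * p - γ) * h d := by
  simp [walk, ← sub_eq_add_neg]
  ring

/-- A vote for `l` raises the difference, a vote for `r` lowers it, and every other vote leaves it
unchanged; hence the difference is itself a Markov chain. -/
lemma voteExp_diff {k : ℕ} {γ : ℝ} {r l : Fin k} (hl : l ≠ r) (h : ℤ → ℝ) (m : ℕ)
    (s : Fin k → ℕ) :
    voteExp γ r m (fun s => h ((s l : ℤ) - s r)) s
      = (walk ((1 - γ) / k) γ ^ m) h ((s l : ℤ) - s r) := by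
  induction m generalizing s with
  | zero => rfl
  | succ m ih =>
    have hk : (k : ℝ) ≠ 0 := by
      have := r.pos
      positivity
    simp only [voteExp, ih, pow_succ', Module.End.mul_apply]
    generalize (walk ((1 - γ) / k) γ ^ m) h = f
    rw [walk_apply, sum_edgeDist_mul]
    have hF : ∀ a : Fin k, f (((s + Pi.single a 1 : Fin k → ℕ) l : ℤ)
          - (s + Pi.single a 1 : Fin k → ℕ) r)
        = f ((s l : ℤ) - s r) + (if a = l then f ((s l : ℤ) - s r + 1) - f ((s l : ℤ) - s r) else 0)
          + (if a = r then f ((s l : ℤ) - s r - 1) - f ((s l : ℤ) - s r) else 0) := by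
      intro a
      by_cases h1 : a = l
      · subst h1
        simp [hl, hl.symm, add_sub_right_comm]
      · by_cases h2 : a = r
        · subst h2
          simp [hl, hl.symm, sub_sub]
        · simp [h1, h2, Ne.symm h1, Ne.symm h2]
    simp only [hF, Finset.sum_add_distrib, Finset.sum_ite_eq', Finset.mem_univ, if_true,
      Finset.sum_const, Finset.card_univ, Fintype.card_fin, nsmul_eq_mul, hl.symm, if_false]
    field_simp
    ring

/-! ### Anticoncentration of the walk -/

/-- For even `j`, induction with the ratio of central binomials reduces to $(2n+3)(2n+1)\le
4(n+1)^2$. Odd `j` follows from $\binom{2n+2}{n+1}=2\binom{2n+1}{n}$. -/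
lemma succ_mul_choose_half_sq_le (j : ℕ) : (j + 1) * (j.choose (j / 2)) ^ 2 ≤ 4 ^ j := by
  have key : ∀ n : ℕ, (2 * n + 1) * n.centralBinom ^ 2 ≤ 16 ^ n := by
    intro n
    induction n with
    | zero => simp
    | succ n ih =>
      have h := Nat.succ_mul_centralBinom_succ n
      have hpos : 0 < (n + 1) ^ 2 := by positivity
      refine Nat.le_of_mul_le_mul_left (?_ : (n + 1) ^ 2 * _ ≤ (n + 1) ^ 2 * _) hpos
      calc (n + 1) ^ 2 * ((2 * (n + 1) + 1) * (n + 1).centralBinom ^ 2)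
          = (2 * n + 3) * ((n + 1) * (n + 1).centralBinom) ^ 2 := by ring
        _ = 4 * ((2 * n + 3) * (2 * n + 1)) * ((2 * n + 1) * n.centralBinom ^ 2) := by
            rw [h]; ring
        _ ≤ 4 * (4 * (n + 1) ^ 2) * 16 ^ n := by
            refine Nat.mul_le_mul (Nat.mul_le_mul_left 4 ?_) ih
            nlinarith
        _ = (n + 1) ^ 2 * 16 ^ (n + 1) := by ring
  rcases Nat.even_or_odd' j with ⟨n, rfl | rfl⟩
  · have h := key n
    rw [Nat.centralBinom] at h
    simpa [pow_mul] using h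
  · have h := key (n + 1)
    have h2 : (n + 1).centralBinom = 2 * (2 * n + 1).choose n := by
      rw [Nat.centralBinom, show 2 * (n + 1) = (2 * n + 1) + 1 by ring, Nat.choose_succ_succ,
        Nat.choose_symm_half]
      ring
    rw [h2] at h
    have h3 : 16 ^ (n + 1) = 4 * 4 ^ (2 * n + 1) := by
      rw [← pow_succ', show 2 * n + 1 + 1 = 2 * (n + 1) by ring, pow_mul]
      norm_num
    rw [show (2 * n + 1) / 2 = n by omega]
    nlinarith

/-- The indicator of `{-1, 0}`. -/
noncomputable def nearTie (d : ℤ) : ℝ := if d = 0 ∨ d = -1 then 1 else 0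

/-- After `j` steps of size one the parity of the position is fixed, so only one of `0` and `-1` can
be reached, and by one number of up-steps. The sum is thus at most one binomial coefficient, bounded
by the middle one. -/
lemma symm_pow_nearTie_le (j : ℕ) (d : ℤ) :
    ((shift 1 + shift (-1)) ^ j) nearTie d ≤ 2 ^ j / Real.sqrt (j + 1) := by
  have h1 : ((shift 1 + shift (-1)) ^ j) nearTie d
      = ∑ i ∈ Finset.range (j + 1), (j.choose i : ℝ) * nearTie (d + (2 * i - j)) := by
    rw [(shift_commute 1 (-1)).add_pow, LinearMap.sum_apply, Finset.sum_apply]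
    refine Finset.sum_congr rfl fun i hi => ?_
    rw [shift_pow, shift_pow, shift_mul, ← Nat.cast_comm, ← nsmul_eq_mul]
    have : i ≤ j := by simpa [Nat.lt_succ_iff] using hi
    rw [LinearMap.smul_apply, Pi.smul_apply, nsmul_eq_mul, shift_apply]
    congr 3
    push_cast [this]
    ring
  have h2 : ((j.choose (j / 2) : ℕ) : ℝ) ≤ 2 ^ j / Real.sqrt (j + 1) := by
    rw [le_div_iff₀ (by positivity)]
    refine abs_le_of_sq_le_sq' ?_ (by positivity) |>.2
    rw [mul_pow, Real.sq_sqrt (by positivity), ← pow_mul, mul_comm j 2, pow_mul]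
    have := succ_mul_choose_half_sq_le j
    have h3 : (((j + 1) * (j.choose (j / 2)) ^ 2 : ℕ) : ℝ) ≤ ((4 ^ j : ℕ) : ℝ) := by
      exact_mod_cast this
    push_cast at h3
    norm_num
    linarith
  rw [h1]
  refine le_trans ?_ h2
  by_cases hi : ∃ i ∈ Finset.range (j + 1), nearTie (d + (2 * i - j)) ≠ 0
  · obtain ⟨i, hi, hne⟩ := hi
    have hi' : d + (2 * (i : ℤ) - j) = 0 ∨ d + (2 * (i : ℤ) - j) = -1 := by
      by_contra hcon
      exact hne (by simp only [nearTie, if_neg hcon])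
    rw [Finset.sum_eq_single_of_mem i hi]
    · have : nearTie (d + (2 * i - j)) = 1 := by simp only [nearTie, if_pos hi']
      rw [this, mul_one]
      exact_mod_cast Nat.choose_le_middle i j
    · intro b _ hb
      have : ¬ (d + (2 * (b : ℤ) - j) = 0 ∨ d + (2 * (b : ℤ) - j) = -1) := by omega
      simp only [nearTie, if_neg this, mul_zero]
  · push Not at hi
    rw [Finset.sum_eq_zero fun i h => by rw [hi i h, mul_zero]]
    positivity

/-- The mean of $1/\sqrt{j+1}$ for binomial $j$ is controlled by the mean of $1/(j+1)$, which is
computable; AM-GM, balanced at $a=\sqrt{\rho(m+1)}$, replaces the square root. -/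
lemma sum_binomial_div_sqrt_le {ρ : ℝ} (h0 : 0 < ρ) (h1 : ρ ≤ 1) (m : ℕ) :
    ∑ j ∈ Finset.range (m + 1), ρ ^ j * (1 - ρ) ^ (m - j) * m.choose j / Real.sqrt (j + 1)
      ≤ 1 / Real.sqrt (ρ * (m + 1)) := by
  set a := Real.sqrt (ρ * (m + 1)) with ha
  have ha0 : 0 < a := Real.sqrt_pos.2 (by positivity)
  have ha2 : a ^ 2 = ρ * (m + 1) := Real.sq_sqrt (by positivity)
  have hb : ∀ j, 0 ≤ ρ ^ j * (1 - ρ) ^ (m - j) * (m.choose j : ℝ) := fun j => by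
    have : 0 ≤ 1 - ρ := by linarith
    positivity
  have hs1 : ∑ j ∈ Finset.range (m + 1), ρ ^ j * (1 - ρ) ^ (m - j) * (m.choose j : ℝ) = 1 := by
    rw [← add_pow]; simp
  have hs2 : ∑ j ∈ Finset.range (m + 1), ρ ^ j * (1 - ρ) ^ (m - j) * m.choose j / ((j : ℝ) + 1)
      ≤ 1 / a ^ 2 := by
    rw [ha2, le_div_iff₀ (by positivity), Finset.sum_mul]
    -- Since $(m+1)\binom mj=(j+1)\binom{m+1}{j+1}$, the sum is this expansion of $1$ without its
    -- term $j=0$.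
    have h3 : ∑ j ∈ Finset.range (m + 1 + 1),
        ρ ^ j * (1 - ρ) ^ (m + 1 - j) * ((m + 1).choose j : ℝ) = 1 := by
      rw [← add_pow]; simp
    rw [Finset.sum_range_succ'] at h3
    have h4 : 0 ≤ ρ ^ 0 * (1 - ρ) ^ (m + 1 - 0) * ((m + 1).choose 0 : ℝ) := by
      have : 0 ≤ 1 - ρ := by linarith
      positivity
    refine le_trans (le_of_eq (Finset.sum_congr rfl fun j _ => ?_)) (by linarith : _ ≤ (1 : ℝ))
    have h5 : ((m + 1 : ℕ) : ℝ) * m.choose j = (m + 1).choose (j + 1) * ((j + 1 : ℕ) : ℝ) := by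
      exact_mod_cast Nat.add_one_mul_choose_eq m j
    push_cast at h5
    rw [Nat.add_sub_add_right]
    field_simp
    rw [mul_assoc, mul_assoc, mul_comm (m.choose j : ℝ), h5]
    ring
  calc ∑ j ∈ Finset.range (m + 1), ρ ^ j * (1 - ρ) ^ (m - j) * m.choose j / Real.sqrt (j + 1)
      ≤ ∑ j ∈ Finset.range (m + 1),
          (a / 2 * (ρ ^ j * (1 - ρ) ^ (m - j) * m.choose j / ((j : ℝ) + 1))
            + 1 / (2 * a) * (ρ ^ j * (1 - ρ) ^ (m - j) * m.choose j)) := by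
        refine Finset.sum_le_sum fun j _ => ?_
        set b := Real.sqrt ((j : ℝ) + 1)
        have hb0 : 0 < b := Real.sqrt_pos.2 (by positivity)
        have hb2 : b ^ 2 = (j : ℝ) + 1 := Real.sq_sqrt (by positivity)
        have : 1 / b ≤ a / 2 * (1 / b ^ 2) + 1 / (2 * a) := by
          rw [← sub_nonneg]
          have : a / 2 * (1 / b ^ 2) + 1 / (2 * a) - 1 / b = (a - b) ^ 2 / (2 * a * b ^ 2) := by
            field_simp
            ring
          rw [this]
          positivity
        rw [← hb2]
        calc _ = ρ ^ j * (1 - ρ) ^ (m - j) * (m.choose j : ℝ) * (1 / b) := by ring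
          _ ≤ _ := mul_le_mul_of_nonneg_left this (hb j)
          _ = _ := by ring
    _ ≤ a / 2 * (1 / a ^ 2) + 1 / (2 * a) * 1 := by
        rw [Finset.sum_add_distrib, ← Finset.mul_sum, ← Finset.mul_sum, hs1]
        gcongr
    _ = 1 / a := by field_simp; ring

/-- The walk is a mixture of a symmetric step of mass $2p$ and a remainder `Q` with nonnegative
coefficients of total $1-2p$. The two commute, so the power expands binomially in the number `j` of
symmetric steps. These give the bound $1/\sqrt{j+1}$, and `Q` preserves upper bounds up to its mass.
-/
lemma walk_pow_nearTie_le {p γ : ℝ} (hp : 0 < p) (hγ : 0 ≤ γ) (hpγ : 2 * p + γ ≤ 1) (m : ℕ)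
    (d : ℤ) : (walk p γ ^ m) nearTie d ≤ 1 / Real.sqrt (2 * p * (m + 1)) := by
  refine le_trans ?_ (sum_binomial_div_sqrt_le (by linarith : 0 < 2 * p) (by linarith) m)
  set A := shift 1 + shift (-1)
  set Q : Module.End ℝ (ℤ → ℝ) := γ • shift (-1) + (1 - 2 * p - γ) • shift 0
  have hAQ : Commute (p • A) Q := by
    refine Commute.smul_left (Commute.add_left ?_ ?_) p <;>
    exact (((shift_commute _ _).smul_right _).add_right ((shift_commute _ _).smul_right _))
  have hQ : ∀ (n : ℕ) (f : ℤ → ℝ) (B : ℝ), (∀ d, f d ≤ B) → ∀ d, (Q ^ n) f d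
      ≤ (1 - 2 * p) ^ n * B := by
    intro n f B hf
    induction n with
    | zero => simpa using hf
    | succ n ih =>
      intro d
      rw [pow_succ', Module.End.mul_apply]
      have h1 := mul_le_mul_of_nonneg_left (ih (d + -1)) hγ
      have h2 := mul_le_mul_of_nonneg_left (ih (d + 0)) (by linarith : 0 ≤ 1 - 2 * p - γ)
      calc Q ((Q ^ n) f) d
          = γ * (Q ^ n) f (d + -1) + (1 - 2 * p - γ) * (Q ^ n) f (d + 0) := rfl
        _ ≤ _ := add_le_add h1 h2
        _ = _ := by ring
  rw [walk, hAQ.add_pow, LinearMap.sum_apply, Finset.sum_apply]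
  refine Finset.sum_le_sum fun j _ => ?_
  rw [(hAQ.pow_pow j (m - j)).eq, ← Nat.cast_comm, ← nsmul_eq_mul, smul_pow,
    LinearMap.smul_apply, Pi.smul_apply, Module.End.mul_apply, LinearMap.smul_apply, nsmul_eq_mul]
  have h := hQ (m - j) (p ^ j • (A ^ j) nearTie) (p ^ j * (2 ^ j / Real.sqrt (j + 1)))
    (fun d => mul_le_mul_of_nonneg_left (symm_pow_nearTie_le j d) (by positivity)) d
  refine (mul_le_mul_of_nonneg_left h (Nat.cast_nonneg _)).trans (le_of_eq ?_)
  rw [mul_pow]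
  ring

/-! ### Bounds on the potential -/

section potential
variable {k : ℕ} {γ : ℝ} {r : Fin k}

lemma zeroOneLoss_nonneg (s : Fin k → ℕ) : 0 ≤ zeroOneLoss r s := by
  unfold zeroOneLoss; split_ifs <;> norm_num

lemma zeroOneLoss_le_one (s : Fin k → ℕ) : zeroOneLoss r s ≤ 1 := by
  unfold zeroOneLoss; split_ifs <;> norm_num

lemma potential_nonneg (h0 : 0 ≤ γ) (h1 : γ ≤ 1) (m : ℕ) (s : Fin k → ℕ) :
    0 ≤ potential γ r m s := by
  rw [potential_eq_voteExp]
  exact (voteExp_const 0 m s).ge.trans (voteExp_mono h0 h1 zeroOneLoss_nonneg m s)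

lemma potential_le_one (h0 : 0 ≤ γ) (h1 : γ ≤ 1) (m : ℕ) (s : Fin k → ℕ) :
    potential γ r m s ≤ 1 := by
  rw [potential_eq_voteExp]
  exact (voteExp_mono h0 h1 zeroOneLoss_le_one m s).trans (voteExp_const 1 m s).le

/-- Moving a vote to the true label can only lower the loss. This is why the costs are nonnegative.
-/
lemma potential_correct_le (h0 : 0 ≤ γ) (h1 : γ ≤ 1) (m : ℕ) (s : Fin k → ℕ) (l : Fin k) :
    potential γ r m (s + Pi.single r 1) ≤ potential γ r m (s + Pi.single l 1) := by
  rw [potential_eq_voteExp, potential_eq_voteExp, voteExp_add_right, voteExp_add_right]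
  refine voteExp_mono h0 h1 (fun s => ?_) m s
  unfold zeroOneLoss
  by_cases h : ∃ a, a ≠ r ∧ (s + Pi.single r 1 : Fin k → ℕ) r ≤ (s + Pi.single r 1 : Fin k → ℕ) a
  · obtain ⟨a, har, ha⟩ := h
    have : ∃ a, a ≠ r ∧ (s + Pi.single l 1 : Fin k → ℕ) r ≤ (s + Pi.single l 1 : Fin k → ℕ) a := by
      refine ⟨a, har, ?_⟩
      simp [har] at ha
      simp only [Pi.add_apply, Pi.single_apply]
      split_ifs <;> omega
    rw [if_pos this]
    split_ifs <;> norm_num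
  · rw [if_neg h]
    split_ifs <;> norm_num

/-- If a vote for `l` loses and a vote for `r` would not, some rival `a` trails or ties `r`, yet by
at most one vote: the difference is `0` or `-1`. -/
lemma zeroOneLoss_vote_le (s : Fin k → ℕ) (l : Fin k) :
    zeroOneLoss r (s + Pi.single l 1) ≤ zeroOneLoss r (s + Pi.single r 1)
      + ∑ a ∈ Finset.univ.erase r, nearTie ((s a : ℤ) - s r) := by
  have hn : ∀ d, 0 ≤ nearTie d := fun d => by unfold nearTie; split_ifs <;> norm_num
  have hsum : 0 ≤ ∑ a ∈ Finset.univ.erase r, nearTie ((s a : ℤ) - s r) :=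
    Finset.sum_nonneg fun a _ => hn _
  have h2 := zeroOneLoss_nonneg (r := r) (s + Pi.single r 1)
  by_cases h : ∃ a, a ≠ r ∧ (s + Pi.single l 1 : Fin k → ℕ) r ≤ (s + Pi.single l 1 : Fin k → ℕ) a
  · obtain ⟨a, har, ha⟩ := h
    by_cases hs : s r + 1 ≤ s a
    · have : zeroOneLoss r (s + Pi.single r 1) = 1 := by
        unfold zeroOneLoss
        exact if_pos ⟨a, har, by simpa [har] using hs⟩
      rw [this]
      linarith [zeroOneLoss_le_one (r := r) (s + Pi.single l 1)]
    · have hd : (s a : ℤ) - s r = 0 ∨ (s a : ℤ) - s r = -1 := by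
        simp only [Pi.add_apply, Pi.single_apply] at ha
        split_ifs at ha <;> omega
      have h3 : nearTie ((s a : ℤ) - s r) = 1 := by simp only [nearTie, if_pos hd]
      have h4 := Finset.single_le_sum (f := fun a => nearTie ((s a : ℤ) - s r))
        (fun a _ => hn _) (Finset.mem_erase.2 ⟨har, Finset.mem_univ a⟩)
      simp only [h3] at h4
      linarith [zeroOneLoss_le_one (r := r) (s + Pi.single l 1)]
  · have : zeroOneLoss r (s + Pi.single l 1) = 0 := if_neg h
    rw [this]
    exact add_nonneg h2 hsum

lemma potential_diff_le (hk : 2 ≤ k) (h0 : 0 < γ) (h1 : γ < 1 / 2) (m : ℕ) (s : Fin k → ℕ)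
    (l : Fin k) :
    potential γ r m (s + Pi.single l 1) - potential γ r m (s + Pi.single r 1)
      ≤ (k - 1) * Real.sqrt (k / (m + 1)) := by
  have hk2 : (2 : ℝ) ≤ k := by exact_mod_cast hk
  have hk0 : (0 : ℝ) < k := by linarith
  -- The hypothesis $\gamma<1/2$ gives the symmetric part of the walk mass at least $1/k$, uniformly
  -- in $\gamma$.
  have hp : 1 / k ≤ 2 * ((1 - γ) / k) := by
    rw [← mul_div_assoc]
    gcongr
    linarith
  have hp0 : 0 < (1 - γ) / k := div_pos (by linarith) hk0
  have hp1 : 2 * ((1 - γ) / k) + γ ≤ 1 := by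
    have : (1 - γ) / k ≤ (1 - γ) / 2 := div_le_div_of_nonneg_left (by linarith) (by norm_num) hk2
    linarith
  rw [sub_le_iff_le_add, potential_eq_voteExp, potential_eq_voteExp, voteExp_add_right,
    voteExp_add_right, add_comm]
  refine (voteExp_mono h0.le (by linarith) (fun s => zeroOneLoss_vote_le s l) m s).trans ?_
  rw [voteExp_add, voteExp_sum]
  gcongr
  calc _ ≤ ∑ a ∈ Finset.univ.erase r, Real.sqrt (k / (m + 1)) := by
        refine Finset.sum_le_sum fun a ha => ?_
        rw [voteExp_diff (Finset.ne_of_mem_erase ha)]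
        refine (walk_pow_nearTie_le hp0 h0.le hp1 m _).trans ?_
        rw [one_div, ← Real.sqrt_inv, ← one_div]
        refine Real.sqrt_le_sqrt ?_
        rw [div_le_div_iff₀ (mul_pos (mul_pos two_pos hp0) (by positivity)) (by positivity)]
        have h5 := mul_le_mul_of_nonneg_left hp hk0.le
        have : (k : ℝ) * (1 / k) = 1 := by field_simp
        rw [this] at h5
        have := mul_le_mul_of_nonneg_right h5 (by positivity : (0 : ℝ) ≤ m + 1)
        linarith
    _ = (k - 1) * Real.sqrt (k / (m + 1)) := by
        rw [Finset.sum_const, Finset.card_erase_of_mem (Finset.mem_univ r), Finset.card_univ,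
          Fintype.card_fin, nsmul_eq_mul, Nat.cast_sub (by omega), Nat.cast_one]

lemma rawWeight_nonneg (h0 : 0 ≤ γ) (h1 : γ ≤ 1) (m : ℕ) (s : Fin k → ℕ) :
    0 ≤ rawWeight γ m s r :=
  Finset.sum_nonneg fun l _ => sub_nonneg.2 (potential_correct_le h0 h1 m s l)

/-- There are $k$ summands, each at most $(k-1)\sqrt{k/(m+1)}\le k\sqrt{k/m}$; hence the power $5/2$
and the constant $c=1$. For $m=0$ each summand is trivially at most $1$. -/
lemma rawWeight_le_weightEstimate (hk : 2 ≤ k) (h0 : 0 < γ) (h1 : γ < 1 / 2) (m : ℕ)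
    (s : Fin k → ℕ) : rawWeight γ m s r ≤ weightEstimate 1 k m := by
  unfold weightEstimate rawWeight
  split_ifs with hm
  · calc _ ≤ ∑ _l : Fin k, (1 : ℝ) := by
          refine Finset.sum_le_sum fun l _ => ?_
          linarith [potential_le_one (r := r) h0.le (by linarith : γ ≤ 1) m (s + Pi.single l 1),
            potential_nonneg (r := r) h0.le (by linarith : γ ≤ 1) m (s + Pi.single r 1)]
      _ = k := by simp
  · have hm0 : (0 : ℝ) < m := by positivity
    have hk0 : (0 : ℝ) < k := by positivity
    have hk52 : (k : ℝ) ^ (5 / 2 : ℝ) = k * k * Real.sqrt k := by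
      rw [Real.sqrt_eq_rpow, show (5 / 2 : ℝ) = 1 + 1 + 1 / 2 by norm_num, Real.rpow_add hk0,
        Real.rpow_add hk0, Real.rpow_one]
    calc _ ≤ ∑ _l : Fin k, (k : ℝ) * Real.sqrt (k / m) := by
          refine Finset.sum_le_sum fun l _ => (potential_diff_le hk h0 h1 m s l).trans ?_
          gcongr
          · linarith
          · linarith
      _ = 1 * (k : ℝ) ^ (5 / 2 : ℝ) / Real.sqrt m := by
          rw [hk52, Real.sqrt_div hk0.le]
          simp
          ring

lemma mbbmCost_isAdmissible (h0 : 0 ≤ γ) (h1 : γ ≤ 1) (m : ℕ) (s : Fin k → ℕ) :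
    IsAdmissibleCost (mbbmCost γ m s) := by
  intro r
  refine ⟨by simp [mbbmCost], fun l => div_nonneg (sub_nonneg.2 (potential_correct_le h0 h1 m s l))
    (rawWeight_nonneg h0 h1 m s), ?_⟩
  by_cases h : rawWeight γ m s r = 0
  · right
    intro l
    simp [mbbmCost, h]
  · left
    simp only [mbbmCost]
    rw [← Finset.sum_div]
    exact div_self h

/-- The division by zero is harmless: a vanishing raw weight is a sum of nonnegative terms, so each
potential difference vanishes too. -/
lemma rawWeight_mul_mbbmCost (h0 : 0 ≤ γ) (h1 : γ ≤ 1) (m : ℕ) (s : Fin k → ℕ) (l : Fin k) :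
    rawWeight γ m s r * mbbmCost γ m s r l
      = potential γ r m (s + Pi.single l 1) - potential γ r m (s + Pi.single r 1) := by
  by_cases h : rawWeight γ m s r = 0
  · have := (Finset.sum_eq_zero_iff_of_nonneg
      (fun l _ => sub_nonneg.2 (potential_correct_le h0 h1 m s l))).1 h l (Finset.mem_univ l)
    rw [h, zero_mul, this]
  · exact mul_div_cancel₀ _ h

/-- Averaging over $u^r_\gamma$ gives $\Phi_{m+1}(s)=\Phi_m(s+e_r)+\frac{1-\gamma}k W$ with $W$ the
raw weight, while $\Phi_m(s+e_l)-\Phi_m(s+e_r)$ is $W$ times the cost. -/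
lemma potential_step (h0 : 0 ≤ γ) (h1 : γ ≤ 1) (m : ℕ) (s : Fin k → ℕ) (l : Fin k) :
    potential γ r m (s + Pi.single l 1) - potential γ r (m + 1) s
      = rawWeight γ m s r * (mbbmCost γ m s r l - (1 - γ) / k) := by
  have hk : (k : ℝ) ≠ 0 := by
    have := r.pos
    positivity
  rw [mul_sub, rawWeight_mul_mbbmCost h0 h1, potential, sum_edgeDist_mul, rawWeight,
    Finset.sum_sub_distrib]
  simp
  field_simp
  ring

lemma sqrt_sq_sub_le_exp :
    Real.sqrt ((1 + γ) * (1 - γ)) ≤ Real.exp (-(γ ^ 2 / 2)) := by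
  refine Real.sqrt_le_iff.2 ⟨by positivity, ?_⟩
  rw [← Real.exp_nat_mul]
  have := Real.add_one_le_exp (((2 : ℕ) : ℝ) * -(γ ^ 2 / 2))
  push_cast at this ⊢
  nlinarith

/-- Chernoff bound: the loss is at most $\sum_{l\ne r}z^{s[l]-s[r]}$ for $z\ge1$, and $d\mapsto z^d$
is an eigenfunction of the walk with eigenvalue `M`. -/
lemma potential_zero_le (hk : 2 ≤ k) (h0 : 0 < γ) (h1 : γ < 1 / 2) (N : ℕ) :
    potential γ r N 0 ≤ (k - 1) * Real.exp (-(γ ^ 2 * N / 2)) := by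
  have hk2 : (2 : ℝ) ≤ k := by exact_mod_cast hk
  set a := Real.sqrt (1 + γ) with ha
  set b := Real.sqrt (1 - γ) with hb
  have ha0 : 0 < a := Real.sqrt_pos.2 (by linarith)
  have hb0 : 0 < b := Real.sqrt_pos.2 (by linarith)
  have ha2 : a ^ 2 = 1 + γ := Real.sq_sqrt (by linarith)
  have hb2 : b ^ 2 = 1 - γ := Real.sq_sqrt (by linarith)
  have hab : a * b ≤ Real.exp (-(γ ^ 2 / 2)) := by
    rw [ha, hb, ← Real.sqrt_mul (by linarith)]
    exact sqrt_sq_sub_le_exp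
  -- This `z` minimizes `M` when $k=2$.
  set z := a / b with hz
  have hz0 : 0 < z := by positivity
  have hz1 : 1 ≤ z := by
    rw [hz, le_div_iff₀ hb0, one_mul]
    exact Real.sqrt_le_sqrt (by linarith)
  set p := (1 - γ) / (k : ℝ) with hp
  have hp2 : p ≤ (1 - γ) / 2 := div_le_div_of_nonneg_left (by linarith) (by norm_num) hk2
  set M := p * z + (p + γ) * z⁻¹ + (1 - 2 * p - γ) with hM
  have hp0 : 0 ≤ p := div_nonneg (by linarith) (by linarith)
  have hMnn : 0 ≤ M := by
    have : 0 ≤ 1 - 2 * p - γ := by linarith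
    positivity
  -- As $z+z^{-1}\ge2$, `M` is nondecreasing in `p`; at the largest value $p=(1-\gamma)/2$, attained
  -- for $k=2$, it equals $ab=\sqrt{1-\gamma^2}$.
  have hMle : M ≤ a * b := by
    have e1 : a * b = (1 - γ) / 2 * (z + z⁻¹ - 2) + γ * z⁻¹ + (1 - γ) := by
      rw [← hb2, show γ = (a ^ 2 - b ^ 2) / 2 by linarith, hz]
      field_simp
      ring_nf
    have e2 : 0 ≤ z + z⁻¹ - 2 := by
      have : z + z⁻¹ - 2 = (z - 1) ^ 2 / z := by field_simp; ring
      rw [this]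
      positivity
    have e3 : M = p * (z + z⁻¹ - 2) + γ * z⁻¹ + (1 - γ) := by rw [hM]; ring
    rw [e1, e3]
    gcongr
  have hwalk : ∀ n : ℕ, (walk p γ ^ n) (fun d => z ^ d) = fun d => M ^ n * z ^ d := by
    intro n
    induction n with
    | zero => simp
    | succ n ih =>
      ext d
      rw [pow_succ', Module.End.mul_apply, ih, walk_apply, zpow_add_one₀ hz0.ne',
        zpow_sub_one₀ hz0.ne', pow_succ, hM]
      ring
  have hloss : ∀ s : Fin k → ℕ, zeroOneLoss r s
      ≤ ∑ l ∈ Finset.univ.erase r, z ^ ((s l : ℤ) - s r) := by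
    intro s
    have hnn : ∀ l ∈ Finset.univ.erase r, 0 ≤ z ^ ((s l : ℤ) - s r) := fun l _ => by positivity
    unfold zeroOneLoss
    split_ifs with h
    · obtain ⟨l, hl, hs⟩ := h
      refine le_trans ?_ (Finset.single_le_sum hnn (Finset.mem_erase.2 ⟨hl, Finset.mem_univ l⟩))
      exact one_le_zpow₀ hz1 (by omega)
    · exact Finset.sum_nonneg hnn
  rw [potential_eq_voteExp]
  refine (voteExp_mono h0.le (by linarith) hloss N 0).trans ?_
  rw [voteExp_sum]
  calc _ = ∑ l ∈ Finset.univ.erase r, M ^ N := by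
        refine Finset.sum_congr rfl fun l hl => ?_
        rw [voteExp_diff (Finset.ne_of_mem_erase hl) (fun d => z ^ d), ← hp, hwalk]
        simp
    _ = (k - 1) * M ^ N := by
        rw [Finset.sum_const, Finset.card_erase_of_mem (Finset.mem_univ r), Finset.card_univ,
          Fintype.card_fin, nsmul_eq_mul, Nat.cast_sub (by omega), Nat.cast_one]
    _ ≤ (k - 1) * Real.exp (-(γ ^ 2 / 2)) ^ N := by
        gcongr
        · linarith
        · exact hMle.trans hab
    _ = _ := by
        rw [← Real.exp_nat_mul]
        ring_nf

end potential

/-! ### Votes and the telescoping of the potential -/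

lemma votes_zero {k N : ℕ} (p : Fin N → Fin k) : votes p 0 = 0 := by
  ext a
  simp [votes]

lemma votes_succ {k N : ℕ} (p : Fin N → Fin k) (i : Fin N) :
    votes p (i + 1) = votes p i + Pi.single (p i) 1 := by
  ext a
  have hset : Finset.univ.filter (fun j : Fin N => (j : ℕ) < i + 1 ∧ p j = a)
      = Finset.univ.filter (fun j : Fin N => (j : ℕ) < i ∧ p j = a)
        ∪ (if p i = a then {i} else ∅) := by
    ext j
    by_cases h : p i = a
    · simp only [h, if_true, Finset.mem_filter, Finset.mem_univ, true_and, Finset.mem_union,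
        Finset.mem_singleton]
      constructor
      · rintro ⟨h1, h2⟩
        rcases Nat.lt_succ_iff_lt_or_eq.1 h1 with h3 | h3
        · exact Or.inl ⟨h3, h2⟩
        · exact Or.inr (Fin.ext h3)
      · rintro (⟨h1, h2⟩ | rfl)
        · exact ⟨by omega, h2⟩
        · exact ⟨by omega, h⟩
    · simp only [h, if_false, Finset.mem_filter, Finset.mem_univ, true_and, Finset.union_empty]
      constructor
      · rintro ⟨h1, h2⟩
        refine ⟨?_, h2⟩
        rcases Nat.lt_succ_iff_lt_or_eq.1 h1 with h3 | h3
        · exact h3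
        · exact absurd (Fin.ext h3 ▸ h2) h
      · rintro ⟨h1, h2⟩
        exact ⟨by omega, h2⟩
  simp only [votes, Pi.add_apply, hset]
  rw [Finset.card_union_of_disjoint]
  · by_cases h : p i = a
    · subst h; simp
    · simp [h, Ne.symm h]
  · split_ifs <;> simp

/-- Sum of `potential_step` along the actual votes; the bound `i < N` keeps the truncated
subtraction exact. -/
lemma potential_votes_eq {k N : ℕ} {γ : ℝ} (h0 : 0 ≤ γ) (h1 : γ ≤ 1) (p : Fin N → Fin k)
    (r : Fin k) :
    zeroOneLoss r (votes p N) = potential γ r N 0 + ∑ i : Fin N,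
      rawWeight γ (N - (i + 1)) (votes p i) r
        * (mbbmCost γ (N - (i + 1)) (votes p i) r (p i) - (1 - γ) / k) := by
  have hstep : ∀ i : Fin N, rawWeight γ (N - (i + 1)) (votes p i) r
        * (mbbmCost γ (N - (i + 1)) (votes p i) r (p i) - (1 - γ) / k)
      = potential γ r (N - (i + 1)) (votes p (i + 1)) - potential γ r (N - i) (votes p i) := by
    intro i
    rw [← potential_step h0 h1, votes_succ, show N - (i : ℕ) = N - (i + 1) + 1 by omega]
  rw [Finset.sum_congr rfl fun i _ => hstep i,
    Fin.sum_univ_eq_sum_range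
      (fun i => potential γ r (N - (i + 1)) (votes p (i + 1)) - potential γ r (N - i) (votes p i)),
    Finset.sum_range_sub (fun i => potential γ r (N - i) (votes p i))]
  simp [votes_zero, potential]

lemma weightEstimate_pos {k : ℕ} (hk : 0 < k) (m : ℕ) : 0 < weightEstimate 1 k m := by
  unfold weightEstimate
  split_ifs <;> positivity

lemma sum_weightEstimate_le {k : ℕ} (hk : 1 ≤ k) (N : ℕ) :
    ∑ i : Fin N, weightEstimate 1 k (N - (i + 1)) ≤ 3 * (k : ℝ) ^ (5 / 2 : ℝ) * Real.sqrt N := by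
  have hk1 : (1 : ℝ) ≤ k := by exact_mod_cast hk
  rw [Fin.sum_univ_eq_sum_range (fun i => weightEstimate 1 k (N - (i + 1)))]
  simp only [Nat.sub_add_eq, Nat.sub_right_comm N _ 1]
  rw [Finset.sum_range_reflect (fun i => weightEstimate 1 k i)]
  induction N with
  | zero => simp
  | succ N ih =>
    rw [Finset.sum_range_succ]
    unfold weightEstimate at ih ⊢
    split_ifs with hN
    · subst hN
      have h1 : (k : ℝ) ^ (1 : ℝ) ≤ (k : ℝ) ^ (5 / 2 : ℝ) :=
        Real.rpow_le_rpow_of_exponent_le hk1 (by norm_num)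
      rw [Real.rpow_one] at h1
      simp
      linarith
    · refine (add_le_add_left ih _).trans ?_
      set a := Real.sqrt N
      set b := Real.sqrt ((N + 1 : ℕ) : ℝ)
      have ha0 : 0 < a := Real.sqrt_pos.2 (by positivity)
      have hN1 : (1 : ℝ) ≤ N := by exact_mod_cast Nat.one_le_iff_ne_zero.2 hN
      have ha2 : a ^ 2 = N := Real.sq_sqrt (by positivity)
      have hb0 : 0 < b := Real.sqrt_pos.2 (by positivity)
      have hb2 : b ^ 2 = N + 1 := by
        have := Real.sq_sqrt (by positivity : (0 : ℝ) ≤ ((N + 1 : ℕ) : ℝ))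
        rw [this]; push_cast; rfl
      have hba : b ≤ 2 * a := by
        refine abs_le_of_sq_le_sq' ?_ (by positivity) |>.2
        nlinarith
      -- Here $1=b^2-a^2=(b-a)(b+a)\le 3a(b-a)$, because $b\le 2a$; this is the source of the
      -- constant $3$.
      have hkey : 1 / a ≤ 3 * (b - a) := by
        rw [div_le_iff₀ ha0]
        have hab : a ≤ b := Real.sqrt_le_sqrt (by push_cast; linarith)
        nlinarith [mul_nonneg (sub_nonneg.2 hab) (sub_nonneg.2 hba)]
      have := mul_le_mul_of_nonneg_left hkey (by positivity : 0 ≤ (k : ℝ) ^ (5 / 2 : ℝ))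
      calc _ = 3 * (k : ℝ) ^ (5 / 2 : ℝ) * a + (k : ℝ) ^ (5 / 2 : ℝ) * (1 / a) := by ring
        _ ≤ 3 * (k : ℝ) ^ (5 / 2 : ℝ) * a + (k : ℝ) ^ (5 / 2 : ℝ) * (3 * (b - a)) := by gcongr
        _ = _ := by ring

/-! ### Conditional independence of the label and the predictions -/

section condExp
variable {Ω : Type*} {m mΩ : MeasurableSpace Ω} {μ : Measure Ω}

lemma integral_mul_condExp [IsFiniteMeasure μ] (hm : m ≤ mΩ) {g h : Ω → ℝ}
    (hg : StronglyMeasurable[m] g) (hgh : Integrable (g * h) μ) (hh : Integrable h μ) :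
    ∫ ω, g ω * (μ[h | m]) ω ∂μ = ∫ ω, g ω * h ω ∂μ := by
  have h1 := condExp_mul_of_stronglyMeasurable_left hg hgh hh
  calc ∫ ω, g ω * (μ[h | m]) ω ∂μ = ∫ ω, (μ[g * h | m]) ω ∂μ :=
        integral_congr_ae h1.symm
    _ = ∫ ω, (g * h) ω ∂μ := integral_condExp hm

/-- On the event `l = a`, knowing `l` adds nothing to `m`: the sets with this trace property form a
σ-algebra containing both generators. -/
lemma exists_inter_eq_of_measurableSet_sup_comap {α : Type*} [MeasurableSpace α]
    {l : Ω → α} {s : Set Ω}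
    (hs : MeasurableSet[m ⊔ MeasurableSpace.comap l inferInstance] s) (a : α) :
    ∃ B, MeasurableSet[m] B ∧ s ∩ l ⁻¹' {a} = B ∩ l ⁻¹' {a} := by
  let m' : MeasurableSpace Ω :=
    { MeasurableSet' := fun s => ∃ B, MeasurableSet[m] B ∧ s ∩ l ⁻¹' {a} = B ∩ l ⁻¹' {a}
      measurableSet_empty := ⟨∅, MeasurableSet.empty, rfl⟩
      measurableSet_compl := by
        rintro s ⟨B, hB, h⟩
        refine ⟨Bᶜ, hB.compl, ?_⟩
        ext ω
        have := Set.ext_iff.1 h ω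
        simp only [Set.mem_inter_iff, Set.mem_compl_iff] at this ⊢
        tauto
      measurableSet_iUnion := by
        intro f hf
        choose B hB h using hf
        exact ⟨⋃ i, B i, MeasurableSet.iUnion hB, by simp only [Set.iUnion_inter, h]⟩ }
  have hle : m ⊔ MeasurableSpace.comap l inferInstance ≤ m' := by
    refine sup_le (fun B hB => ⟨B, hB, rfl⟩) ?_
    rintro _ ⟨c, -, rfl⟩
    by_cases ha : a ∈ c
    · refine ⟨Set.univ, @MeasurableSet.univ _ m, ?_⟩
      ext ω
      simp only [Set.mem_inter_iff, Set.mem_preimage, Set.mem_singleton_iff, Set.mem_univ, true_and]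
      exact ⟨fun h => h.2, fun h => ⟨h ▸ ha, h⟩⟩
    · refine ⟨∅, @MeasurableSet.empty _ m, ?_⟩
      ext ω
      simp only [Set.mem_inter_iff, Set.mem_preimage, Set.mem_singleton_iff, Set.mem_empty_iff_false,
        false_and, iff_false, not_and]
      exact fun h h' => ha (h' ▸ h)
  exact hle s hs

/-- If the conditional law of the prediction `l` given `m` and `y` does not depend on `y`, then
observing `l` in addition to `m` gives no information on `y`. -/
lemma condExp_sup_comap_eq [IsFiniteMeasure μ] {k : ℕ} {α : Type*} [MeasurableSpace α]
    (hm : m ≤ mΩ) {y : Ω → α} (hy : Measurable y) {l : Ω → Fin k}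
    (hl : Measurable l) {D : Set α} (hD : MeasurableSet D)
    (hK : ∀ a, ∃ K : Ω → ℝ, StronglyMeasurable[m] K ∧
      μ[(l ⁻¹' {a}).indicator (fun _ => (1 : ℝ)) | m ⊔ MeasurableSpace.comap y inferInstance]
        =ᵐ[μ] K) :
    μ[(y ⁻¹' D).indicator (fun _ => (1 : ℝ)) | m ⊔ MeasurableSpace.comap l inferInstance]
      =ᵐ[μ] μ[(y ⁻¹' D).indicator (fun _ => (1 : ℝ)) | m] := by
  set f : Ω → ℝ := (y ⁻¹' D).indicator (fun _ => (1 : ℝ)) with hf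
  have hml : m ⊔ MeasurableSpace.comap l inferInstance ≤ mΩ := sup_le hm hl.comap_le
  have hmy : m ⊔ MeasurableSpace.comap y inferInstance ≤ mΩ := sup_le hm hy.comap_le
  have hind : ∀ s : Set Ω, ∀ ω, ‖s.indicator (fun _ => (1 : ℝ)) ω‖ ≤ 1 := fun s ω => by
    by_cases h : ω ∈ s <;> simp [h]
  have hint : ∀ s, MeasurableSet s → Integrable (s.indicator (fun _ => (1 : ℝ))) μ :=
    fun s hs => (integrable_const 1).indicator hs
  have hfi : Integrable f μ := hint _ (hy hD)
  have hmulB : ∀ (g : Ω → ℝ), Integrable g μ → ∀ s, MeasurableSet s →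
      Integrable (g * s.indicator (fun _ => (1 : ℝ))) μ := fun g hg s hs =>
    hg.mul_bdd (hint s hs).aestronglyMeasurable (Filter.Eventually.of_forall (hind s))
  have hsm : StronglyMeasurable[m ⊔ MeasurableSpace.comap l inferInstance] (μ[f | m]) :=
    stronglyMeasurable_condExp.mono le_sup_left
  refine (ae_eq_condExp_of_forall_setIntegral_eq hml hfi
    (fun s _ _ => integrable_condExp.integrableOn) ?_ hsm.aestronglyMeasurable).symm
  intro s hs _
  -- On `l = a` the set `s` agrees with some `B` in `m`. Both `f` and its conditional expectation
  -- are measurable for `m` joined with `y`, so the indicator of `l = a` may be replaced by `K` in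
  -- both integrals. As `K` is `m`-measurable, the defining property of `μ[f | m]` finishes.
  have hpiece : ∀ a, ∫ ω in s ∩ l ⁻¹' {a}, (μ[f | m]) ω ∂μ = ∫ ω in s ∩ l ⁻¹' {a}, f ω ∂μ := by
    intro a
    obtain ⟨B, hB, hsB⟩ := exists_inter_eq_of_measurableSet_sup_comap hs a
    obtain ⟨K, hKm, hKe⟩ := hK a
    have hA : MeasurableSet (l ⁻¹' {a}) := hl (measurableSet_singleton a)
    set A : Ω → ℝ := (l ⁻¹' {a}).indicator (fun _ => (1 : ℝ)) with hAdef
    set b : Ω → ℝ := B.indicator (fun _ => (1 : ℝ)) with hb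
    have hbm : StronglyMeasurable[m] b := stronglyMeasurable_const.indicator hB
    have hset : ∀ g : Ω → ℝ, ∫ ω in s ∩ l ⁻¹' {a}, g ω ∂μ = ∫ ω, (g ω * b ω) * A ω ∂μ := by
      intro g
      rw [hsB, ← integral_indicator ((hm B hB).inter hA)]
      congr 1
      ext ω
      by_cases h1 : ω ∈ B <;> by_cases h2 : ω ∈ l ⁻¹' {a} <;>
        simp [hb, hAdef, Set.indicator, h1, h2]
    have hKi : Integrable K μ := (integrable_congr hKe).1 integrable_condExp
    have hfy : StronglyMeasurable[m ⊔ MeasurableSpace.comap y inferInstance] f :=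
      stronglyMeasurable_const.indicator
        ((le_sup_right : MeasurableSpace.comap y inferInstance ≤ m ⊔ _) _ ⟨D, hD, rfl⟩)
    rw [hset, hset]
    have e1 : ∫ ω, (f ω * b ω) * A ω ∂μ = ∫ ω, (f ω * b ω) * K ω ∂μ := by
      have h := integral_mul_condExp (μ := μ) hmy (hfy.mul (hbm.mono le_sup_left))
        (hmulB _ (hmulB f hfi B (hm B hB)) _ hA) (hint _ hA)
      exact h.symm.trans
        (integral_congr_ae (hKe.mono fun ω hω => congrArg ((f * b) ω * ·) hω))
    have e2 : ∫ ω, ((μ[f | m]) ω * b ω) * A ω ∂μ = ∫ ω, ((μ[f | m]) ω * b ω) * K ω ∂μ := by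
      have h := integral_mul_condExp (μ := μ) hmy
        ((stronglyMeasurable_condExp (f := f) (μ := μ) (m := m).mul hbm).mono le_sup_left)
        (hmulB _ (hmulB (μ[f | m]) integrable_condExp B (hm B hB)) _ hA) (hint _ hA)
      exact h.symm.trans
        (integral_congr_ae (hKe.mono fun ω hω => congrArg (((μ[f | m]) * b) ω * ·) hω))
    have e3 : ∫ ω, (b ω * K ω) * (μ[f | m]) ω ∂μ = ∫ ω, (b ω * K ω) * f ω ∂μ := by
      refine integral_mul_condExp hm (hbm.mul hKm) ?_ hfi
      refine hmulB (b * K) ?_ _ (hy hD)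
      rw [mul_comm]
      exact hmulB K hKi B (hm B hB)
    rw [e1, e2]
    simpa only [mul_comm, mul_left_comm, mul_assoc] using e3
  have hdec : ∀ g : Ω → ℝ, Integrable g μ →
      ∫ ω in s, g ω ∂μ = ∑ a, ∫ ω in s ∩ l ⁻¹' {a}, g ω ∂μ := by
    intro g hg
    rw [← integral_iUnion_fintype (fun a => (hml s hs).inter (hl (measurableSet_singleton a)))
      (fun a b hab => Set.disjoint_left.2 fun ω h1 h2 => hab (by
        rw [← show l ω = a from h1.2, ← show l ω = b from h2.2]))
      (fun a => hg.integrableOn)]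
    congr 2
    ext ω
    simp
  rw [hdec _ integrable_condExp, hdec _ hfi]
  exact Finset.sum_congr rfl fun a _ => hpiece a

/-- Predictions made one after another without access to `y` give no information on `y`. -/
lemma condExp_sup_iSup_comap_eq [IsFiniteMeasure μ] {k N : ℕ} {α : Type*} [MeasurableSpace α]
    (hm : m ≤ mΩ) {y : Ω → α} (hy : Measurable y) {l : Fin N → Ω → Fin k}
    (hl : ∀ j, Measurable (l j)) {D : Set α} (hD : MeasurableSet D)
    (hK : ∀ i a, ∃ K : Ω → ℝ,
      StronglyMeasurable[m ⊔ ⨆ j : {j : Fin N // j < i}, MeasurableSpace.comap (l j) inferInstance]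
        K ∧
      μ[(l i ⁻¹' {a}).indicator (fun _ => (1 : ℝ)) | m ⊔ MeasurableSpace.comap y inferInstance
          ⊔ ⨆ j : {j : Fin N // j < i}, MeasurableSpace.comap (l j) inferInstance] =ᵐ[μ] K)
    (n : ℕ) (hn : n ≤ N) :
    μ[(y ⁻¹' D).indicator (fun _ => (1 : ℝ)) |
        m ⊔ ⨆ j : {j : Fin N // (j : ℕ) < n}, MeasurableSpace.comap (l j) inferInstance]
      =ᵐ[μ] μ[(y ⁻¹' D).indicator (fun _ => (1 : ℝ)) | m] := by
  induction n with
  | zero =>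
    have : IsEmpty {j : Fin N // (j : ℕ) < 0} := ⟨fun j => absurd j.2 (Nat.not_lt_zero _)⟩
    rw [iSup_of_empty, sup_bot_eq]
  | succ n ih =>
    set i : Fin N := ⟨n, hn⟩ with hi
    have hsup : (⨆ j : {j : Fin N // (j : ℕ) < n + 1},
          MeasurableSpace.comap (l j) (inferInstance : MeasurableSpace (Fin k)))
        = (⨆ j : {j : Fin N // (j : ℕ) < n}, MeasurableSpace.comap (l j) inferInstance)
          ⊔ MeasurableSpace.comap (l i) inferInstance := by
      refine le_antisymm (iSup_le fun j => ?_) (sup_le (iSup_le fun j => ?_) ?_)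
      · rcases Nat.lt_succ_iff_lt_or_eq.1 j.2 with h | h
        · exact le_sup_of_le_left (le_iSup (fun j : {j : Fin N // (j : ℕ) < n} =>
            MeasurableSpace.comap (l j) inferInstance) ⟨j.1, h⟩)
        · refine le_sup_of_le_right ?_
          rw [show (j : Fin N) = i from Fin.ext h]
      · exact le_iSup (fun j : {j : Fin N // (j : ℕ) < n + 1} =>
            MeasurableSpace.comap (l j) inferInstance) ⟨j.1, Nat.lt_succ_of_lt j.2⟩
      · exact le_iSup (fun j : {j : Fin N // (j : ℕ) < n + 1} =>
            MeasurableSpace.comap (l j) inferInstance) ⟨i, Nat.lt_succ_self n⟩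
    rw [hsup, ← sup_assoc]
    -- The earlier predictions are absorbed into the base σ-algebra, and one more is added.
    refine (condExp_sup_comap_eq (m := m ⊔ ⨆ j : {j : Fin N // (j : ℕ) < n},
        MeasurableSpace.comap (l j) inferInstance)
      (sup_le hm (iSup_le fun j => (hl j).comap_le)) hy (hl i) hD fun a => ?_).trans
      (ih (Nat.le_of_succ_le hn))
    obtain ⟨K, hKm, hKe⟩ := hK i a
    refine ⟨K, hKm, ?_⟩
    rw [sup_right_comm]
    exact hKe

end condExp

/-! ### A run of the booster as a play of each learner -/

lemma measurable_votes {Ω : Type*} {m : MeasurableSpace Ω} {k N : ℕ} {l : Fin N → Ω → Fin k}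
    {n : ℕ} (hl : ∀ j : Fin N, (j : ℕ) < n → Measurable (l j)) :
    Measurable fun ω => votes (fun j => l j ω) n := by
  refine measurable_pi_lambda _ fun a => ?_
  simp only [votes, Finset.card_filter]
  refine Finset.measurable_sum _ fun j _ => ?_
  by_cases hj : (j : ℕ) < n
  · simp only [hj, true_and]
    exact (Measurable.of_discrete (f := fun b : Fin k => if b = a then 1 else 0)).comp (hl j hj)
  · simp only [hj, false_and, if_false]
    exact measurable_const

lemma measurable_kernel_real {Ω α β : Type*} {m : MeasurableSpace Ω} [MeasurableSpace α]
    [MeasurableSpace β] (κ : Kernel α β) {f : Ω → α} (hf : Measurable f) {s : Set β}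
    (hs : MeasurableSet s) : Measurable fun ω => (κ (f ω)).real s :=
  ((κ.measurable_coe hs).comp hf).ennreal_toReal

namespace MBBMRun

variable {X O : Type u} [MeasurableSpace X] [MeasurableSpace O] {k N : ℕ} {c γ : ℝ}
  {adv : Adversary X O k} {wl : Fin N → OnlineLearner X k} {T : ℕ}
  {Ω : Type u} [mΩ : MeasurableSpace Ω] {μ : Measure Ω} (R : MBBMRun c γ adv wl T μ)

/-- What is known when the cost matrix of learner `i` is chosen. -/
abbrev pre (i : Fin N) (t : ℕ) : MeasurableSpace Ω :=
  (R.past t : MeasurableSpace Ω) ⊔ MeasurableSpace.comap (R.x t) inferInstance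
    ⊔ ⨆ j : {j : Fin N // j < i}, MeasurableSpace.comap (R.l t j) inferInstance

/-- What is known, together with the label, before learner `i` predicts. -/
abbrev full (i : Fin N) (t : ℕ) : MeasurableSpace Ω :=
  (R.past t : MeasurableSpace Ω) ⊔ MeasurableSpace.comap (R.x t) inferInstance
    ⊔ MeasurableSpace.comap (R.y t) inferInstance
    ⊔ ⨆ j : {j : Fin N // j < i}, MeasurableSpace.comap (R.l t j) inferInstance

lemma past_le_pre (i : Fin N) (t : ℕ) : R.past t ≤ R.pre i t := le_sup_of_le_left le_sup_left

lemma pre_le_full (i : Fin N) (t : ℕ) : R.pre i t ≤ R.full i t :=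
  sup_le_sup_right le_sup_left _

lemma full_le_past {t : ℕ} (ht : t < T) (i : Fin N) : R.full i t ≤ R.past (t + 1) :=
  sup_le (sup_le (sup_le (R.past.mono t.le_succ) (R.measurable_x t ht).comap_le)
    (R.measurable_y t ht).comap_le) (iSup_le fun j => (R.measurable_l t ht j).comap_le)

lemma measurable_x_pre (i : Fin N) (t : ℕ) : Measurable[R.pre i t] (R.x t) :=
  Measurable.mono (comap_measurable _) (le_sup_of_le_left le_sup_right) le_rfl

lemma measurable_y_full (i : Fin N) (t : ℕ) : Measurable[R.full i t] (R.y t) :=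
  Measurable.mono (comap_measurable _) (le_sup_of_le_left le_sup_right) le_rfl

lemma measurable_votes_pre (i : Fin N) (t : ℕ) :
    Measurable[R.pre i t] fun ω => votes (fun j => R.l t j ω) i :=
  measurable_votes fun j hj => Measurable.mono (comap_measurable _)
    (le_sup_of_le_right (le_iSup (fun j : {j : Fin N // j < i} =>
      MeasurableSpace.comap (R.l t j) inferInstance) ⟨j, hj⟩)) le_rfl

lemma measurable_C_pre {t : ℕ} (ht : t < T) (i : Fin N) : Measurable[R.pre i t] (R.C t i) := by
  rw [show R.C t i = mbbmCost γ (N - (i + 1)) ∘ fun ω => votes (fun j => R.l t j ω) i from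
    funext (R.C_eq t ht i)]
  exact Measurable.of_discrete.comp (R.measurable_votes_pre i t)

lemma measurable_w_full {t : ℕ} (ht : t < T) (i : Fin N) : Measurable[R.full i t] (R.w t i) := by
  rw [show R.w t i = (fun q : (Fin k → ℕ) × Fin k =>
      rawWeight γ (N - (i + 1)) q.1 q.2 / weightEstimate c k (N - (i + 1)))
    ∘ fun ω => (votes (fun j => R.l t j ω) i, R.y t ω) from funext (R.w_eq t ht i)]
  exact Measurable.of_discrete.comp (Measurable.prodMk
    ((R.measurable_votes_pre i t).mono (R.pre_le_full i t) le_rfl) (R.measurable_y_full i t))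

lemma measurable_record {t : ℕ} (ht : t < T) (i : Fin N) :
    Measurable[R.past t] fun ω (s : Fin t) =>
      ((R.x s ω, R.C s i ω, R.l s i ω, R.y s ω, R.w s i ω) : LearnerRecord X k) := by
  refine @measurable_pi_lambda _ _ _ (R.past t) _ _ fun s => ?_
  have hs : (s : ℕ) < T := s.2.trans ht
  have hle : R.past (s + 1) ≤ R.past t := R.past.mono s.2
  have hfull := (R.full_le_past hs i).trans hle
  exact ((R.measurable_x s hs).mono hle le_rfl).prodMk
    (((R.measurable_C_pre hs i).mono ((R.pre_le_full i s).trans hfull) le_rfl).prodMk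
    (((R.measurable_l s hs i).mono hle le_rfl).prodMk
    (((R.measurable_y s hs).mono hle le_rfl).prodMk
    ((R.measurable_w_full hs i).mono hfull le_rfl))))

/-- The law of each prediction given also the label is a kernel evaluated at data measurable without
the label: the learner's record, `x t` and its cost matrix. -/
lemma no_leak [IsFiniteMeasure μ] {t : ℕ} (ht : t < T) (i : Fin N) (b : Fin k) :
    μ[(R.y t ⁻¹' {b}).indicator (fun _ => (1 : ℝ)) | R.pre i t]
      =ᵐ[μ] μ[(R.y t ⁻¹' {b}).indicator (fun _ => (1 : ℝ)) |
        (R.past t : MeasurableSpace Ω) ⊔ MeasurableSpace.comap (R.x t) inferInstance] := by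
  have hle := R.past.le (t + 1)
  refine condExp_sup_iSup_comap_eq
    (sup_le (R.past.le t) ((R.measurable_x t ht).mono hle le_rfl).comap_le)
    ((R.measurable_y t ht).mono hle le_rfl) (fun j => (R.measurable_l t ht j).mono hle le_rfl)
    (measurableSet_singleton b) (fun i a => ⟨_, ?_, R.prediction_law t ht i a⟩) i i.2.le
  refine Measurable.stronglyMeasurable ?_
  exact measurable_kernel_real (m := R.pre i t) _
    (((R.measurable_record ht i).mono (R.past_le_pre i t) le_rfl).prodMk
      ((R.measurable_x_pre i t).prodMk (R.measurable_C_pre ht i))) (measurableSet_singleton a)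

end MBBMRun

/-! ### From the weak learning conditions to the mistake bound -/

section guarantee

variable {X O : Type u} [MeasurableSpace X] [MeasurableSpace O] {k N : ℕ} {γ : ℝ}
  {adv : Adversary X O k} {wl : Fin N → OnlineLearner X k} {T : ℕ}
  {Ω : Type u} [mΩ : MeasurableSpace Ω] {μ : Measure Ω}

/-- The rounds of a run of the booster, as seen by learner `i`. -/
def MBBMRun.toPlay [IsFiniteMeasure μ] (R : MBBMRun 1 γ adv wl T μ) (hk : 2 ≤ k) (h0 : 0 < γ)
    (h1 : γ < 1 / 2) (i : Fin N) : WeakLearningPlay adv (wl i) T μ where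
  past := R.past
  pre := R.pre i
  full := R.full i
  x := R.x
  y := R.y
  C t := R.C t i
  w t := R.w t i
  l t := R.l t i
  o := R.o
  past_le_pre t _ := R.past_le_pre i t
  pre_le_full t _ := R.pre_le_full i t
  full_le_past t ht := R.full_le_past ht i
  measurable_x t _ := R.measurable_x_pre i t
  measurable_C t ht := R.measurable_C_pre ht i
  measurable_y t _ := R.measurable_y_full i t
  measurable_w t ht := R.measurable_w_full ht i
  measurable_l t ht := R.measurable_l t ht i
  measurable_o t ht := R.measurable_o t ht
  admissible_C t ht ω := by
    rw [R.C_eq t ht i ω]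
    exact mbbmCost_isAdmissible h0.le (by linarith) _ _
  -- The upper bound `1` is where anticoncentration enters.
  mem_w t ht ω := by
    rw [R.w_eq t ht i ω]
    have hpos := weightEstimate_pos (by omega : 0 < k) (N - (i + 1))
    exact ⟨div_nonneg (rawWeight_nonneg h0.le (by linarith) _ _) hpos.le,
      (div_le_one hpos).2 (rawWeight_le_weightEstimate hk h0 h1 _ _)⟩
  example_law := R.example_law
  no_leak t ht b := R.no_leak ht i b
  prediction_law t ht a := R.prediction_law t ht i a

/-- The deterministic part: on the intersection of the learners' good events, sum the telescoped
identity over rounds and exchange the sums. Learner `i` contributes at most `S` times its weight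
estimate. -/
lemma MBBMRun.mistakes_le (R : MBBMRun 1 γ adv wl T μ) (hk : 2 ≤ k) (h0 : 0 < γ)
    (h1 : γ < 1 / 2) {S : ℝ} (hS : 0 ≤ S) (ω : Ω)
    (hω : ∀ i, ∑ t ∈ Finset.range T, R.w t i ω * R.C t i ω (R.y t ω) (R.l t i ω)
      ≤ (1 - γ) / k * ∑ t ∈ Finset.range T, R.w t i ω + S) :
    R.mistakes ω ≤ ((k : ℝ) - 1) * Real.exp (-(γ ^ 2 * N / 2)) * T
      + 3 * (k : ℝ) ^ (5 / 2 : ℝ) * Real.sqrt N * S := by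
  have hround : ∀ t ∈ Finset.range T, (if R.y t ω ≠ R.yhat t ω then (1 : ℝ) else 0)
      ≤ (k - 1) * Real.exp (-(γ ^ 2 * N / 2)) + ∑ i : Fin N, weightEstimate 1 k (N - (i + 1))
        * (R.w t i ω * R.C t i ω (R.y t ω) (R.l t i ω) - (1 - γ) / k * R.w t i ω) := by
    intro t ht
    have ht := Finset.mem_range.1 ht
    -- A wrong winner has at least as many votes as the true label, and ties count as losses, so any
    -- tie-breaking is covered.
    have hloss : (if R.y t ω ≠ R.yhat t ω then (1 : ℝ) else 0)
        ≤ zeroOneLoss (R.y t ω) (votes (fun j => R.l t j ω) N) := by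
      split_ifs with h
      · exact (if_pos ⟨R.yhat t ω, h.symm, R.majority t ht ω _⟩).ge
      · exact zeroOneLoss_nonneg _
    refine hloss.trans ?_
    rw [potential_votes_eq h0.le (by linarith)]
    refine add_le_add (potential_zero_le hk h0 h1 N) (Finset.sum_le_sum fun i _ => le_of_eq ?_)
    rw [R.w_eq t ht i ω, R.C_eq t ht i ω]
    have := weightEstimate_pos (by omega : 0 < k) (N - (i + 1))
    field_simp
  refine (Finset.sum_le_sum hround).trans ?_
  rw [Finset.sum_add_distrib, Finset.sum_comm]
  refine add_le_add (by simp [mul_comm]) ?_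
  calc _ ≤ ∑ i : Fin N, weightEstimate 1 k (N - (i + 1)) * S := by
        refine Finset.sum_le_sum fun i _ => ?_
        rw [← Finset.mul_sum]
        refine mul_le_mul_of_nonneg_left ?_ (weightEstimate_pos (by omega) _).le
        rw [Finset.sum_sub_distrib, ← Finset.mul_sum]
        linarith [hω i]
    _ ≤ _ := by
        rw [← Finset.sum_mul]
        exact mul_le_mul_of_nonneg_right (sum_weightEstimate_le (by omega) N) hS

lemma one_sub_card_mul_le_measureReal_iInter {ι : Type*} [Fintype ι] [IsProbabilityMeasure μ]
    {δ : ℝ} {A : ι → Set Ω} (hA : ∀ i, MeasurableSet (A i)) (h : ∀ i, 1 - δ ≤ μ.real (A i)) :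
    1 - Fintype.card ι * δ ≤ μ.real (⋂ i, A i) := by
  have h1 : μ.real (⋂ i, A i)ᶜ ≤ Fintype.card ι * δ := by
    rw [Set.compl_iInter]
    refine (measureReal_iUnion_fintype_le _).trans ?_
    calc _ ≤ ∑ _i : ι, δ := Finset.sum_le_sum fun i _ => by
          rw [probReal_compl_eq_one_sub (hA i)]
          linarith [h i]
      _ = _ := by simp
  rw [probReal_compl_eq_one_sub (MeasurableSet.iInter hA)] at h1
  linarith

/-- The union bound passes to complements, which requires measurable events. -/
lemma WeakLearningPlay.measurableSet_bound {wl : OnlineLearner X k} (P : WeakLearningPlay adv wl T μ)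
    (a S : ℝ) : MeasurableSet {ω | ∑ t ∈ Finset.range T, P.w t ω * P.C t ω (P.y t ω) (P.l t ω)
      ≤ a * ∑ t ∈ Finset.range T, P.w t ω + S} := by
  have hle : ∀ t < T, P.full t ≤ mΩ := fun t ht => (P.full_le_past t ht).trans (P.past.le _)
  have hw : ∀ t < T, Measurable (P.w t) := fun t ht => (P.measurable_w t ht).mono (hle t ht) le_rfl
  have hy : ∀ t < T, Measurable (P.y t) := fun t ht => (P.measurable_y t ht).mono (hle t ht) le_rfl
  have hl : ∀ t < T, Measurable (P.l t) :=
    fun t ht => (P.measurable_l t ht).mono (P.past.le _) le_rfl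
  have hC : ∀ t < T, Measurable (P.C t) :=
    fun t ht => (P.measurable_C t ht).mono ((P.pre_le_full t ht).trans (hle t ht)) le_rfl
  refine measurableSet_le (Finset.measurable_sum _ fun t ht => ?_)
    (((Finset.measurable_sum _ fun t ht => ?_).const_mul a).add_const S)
  · have ht := Finset.mem_range.1 ht
    refine (hw t ht).mul ?_
    have hev : Measurable fun q : CostMatrix k × Fin k × Fin k => q.1 q.2.1 q.2.2 :=
      measurable_from_prod_countable_left fun q =>
        (measurable_pi_apply q.2).comp (measurable_pi_apply q.1)
    exact hev.comp ((hC t ht).prodMk ((hy t ht).prodMk (hl t ht)))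
  · exact hw t (Finset.mem_range.1 ht)

end guarantee

theorem mbbmGuarantee {k : ℕ} {γ : ℝ} (hk : 2 ≤ k) (h0 : 0 < γ) (h1 : γ < 1 / 2) (N : ℕ)
    (δ : ℝ) {S : ℝ} (hS : 0 ≤ S) :
    MBBMGuarantee.{u} 1 k N δ γ S (fun T => ((k : ℝ) - 1) * Real.exp (-(γ ^ 2 * N / 2)) * T
      + 3 * (k : ℝ) ^ (5 / 2 : ℝ) * Real.sqrt N * S) := by
  intro X O _ _ adv wl hwl T Ω _ μ _ R
  have h := one_sub_card_mul_le_measureReal_iInter (μ := μ)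
    (fun i => (R.toPlay hk h0 h1 i).measurableSet_bound ((1 - γ) / k) S)
    (fun i => hwl i T Ω μ (R.toPlay hk h0 h1 i))
  rw [Fintype.card_fin] at h
  refine h.trans (measureReal_mono fun ω hω => ?_)
  exact R.mistakes_le hk h0 h1 hS ω fun i => Set.mem_iInter.1 hω i

/-! ### The choice of the number of learners -/

lemma MBBMGuarantee.mono {c : ℝ} {k N : ℕ} {δ γ S : ℝ} {f g : ℕ → ℝ}
    (h : MBBMGuarantee.{u} c k N δ γ S f) (hfg : ∀ T, f T ≤ g T) :
    MBBMGuarantee.{u} c k N δ γ S g := by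
  intro X O _ _ adv wl hwl T Ω _ μ _ R
  exact (h X O adv wl hwl T Ω μ R).trans
    (measureReal_mono fun ω hω => le_trans hω (hfg T))

lemma exp_neg_mul_le_of_log_le {k γ ε x : ℝ} (hk : 1 ≤ k) (hγ : 0 < γ) (hε : 0 < ε)
    (hx : 2 * (1 / γ ^ 2 * Real.log (k / ε)) ≤ x) :
    (k - 1) * Real.exp (-(γ ^ 2 * x / 2)) ≤ ε := by
  have hlog : Real.log (k / ε) ≤ γ ^ 2 * x / 2 := by
    have := mul_le_mul_of_nonneg_left hx (by positivity : 0 ≤ γ ^ 2 / 2)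
    have e : γ ^ 2 / 2 * (2 * (1 / γ ^ 2 * Real.log (k / ε))) = Real.log (k / ε) := by field_simp
    linarith
  calc (k - 1) * Real.exp (-(γ ^ 2 * x / 2)) ≤ k * Real.exp (-Real.log (k / ε)) := by
        gcongr
        linarith
    _ = ε := by
        rw [Real.exp_neg, Real.exp_log (by positivity)]
        field_simp

end OnlineBoosting

theorem corollary1 :
    ∃ c C c₁ c₂ : ℝ, 0 < c ∧ 0 < C ∧ 0 < c₁ ∧ 0 < c₂ ∧
      ∀ (k : ℕ) (γ : ℝ), 2 ≤ k → 0 < γ → γ < 1 / 2 →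
        -- the mistake bound
        (∀ (N : ℕ) (δ S : ℝ), 0 < δ → δ < 1 → 0 < S →
          OnlineBoosting.MBBMGuarantee.{u} c k N δ γ S (fun T =>
            ((k : ℝ) - 1) * Real.exp (-(γ ^ 2 * N / 2)) * T
              + C * (k : ℝ) ^ (5 / 2 : ℝ) * Real.sqrt N * S)) ∧
        -- the number of learners that suffices for the error rate `ε`, and the excess loss
        (∀ ε : ℝ, 0 < ε → ε < 1 →
          (∃ N : ℕ, 2 * (1 / γ ^ 2 * Real.log (k / ε)) ≤ N ∧
            (N : ℝ) ≤ 3 * (1 / γ ^ 2 * Real.log (k / ε))) ∧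
          ∀ N : ℕ, 2 * (1 / γ ^ 2 * Real.log (k / ε)) ≤ N →
            (N : ℝ) ≤ 3 * (1 / γ ^ 2 * Real.log (k / ε)) →
            ∀ δ S : ℝ, 0 < δ → δ < 1 → 0 < S →
              c₁ * ((k : ℝ) ^ (5 / 2 : ℝ) / γ * S * Real.sqrt (Real.log (k / ε)))
                  ≤ C * (k : ℝ) ^ (5 / 2 : ℝ) * Real.sqrt N * S ∧
              C * (k : ℝ) ^ (5 / 2 : ℝ) * Real.sqrt N * S
                  ≤ c₂ * ((k : ℝ) ^ (5 / 2 : ℝ) / γ * S * Real.sqrt (Real.log (k / ε))) ∧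
              OnlineBoosting.MBBMGuarantee.{u} c k N δ γ S (fun T =>
                ε * T + C * (k : ℝ) ^ (5 / 2 : ℝ) * Real.sqrt N * S)) := by
  -- The constants $c=1$ and $C=3$ come from the weight bound and from the sum of the estimates.
  -- Since $\gamma\sqrt{N/L}$ lies in $[\sqrt2,\sqrt3]\subset[1,2]$ with $L=\ln(k/\varepsilon)$, the
  -- excess loss is within the factors $3\cdot1$ and $3\cdot2$.
  refine ⟨1, 3, 3, 6, by norm_num, by norm_num, by norm_num, by norm_num,
    fun k γ hk h0 h1 => ⟨fun N δ S _ _ hS =>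
      OnlineBoosting.mbbmGuarantee hk h0 h1 N δ hS.le, fun ε hε hε1 => ?_⟩⟩
  have hk2 : (2 : ℝ) ≤ k := by exact_mod_cast hk
  set L := Real.log (k / ε) with hL
  have hL2 : Real.log 2 ≤ L := by
    refine Real.log_le_log (by norm_num) ?_
    rw [le_div_iff₀ hε]
    nlinarith
  have hL0 : 0 < L := lt_of_lt_of_le (Real.log_pos (by norm_num)) hL2
  -- From $\gamma^2<1/4<\ln2\le L$; the interval allowed for `N` then has length at least $1$, so
  -- the ceiling of its left end fits.
  have hL1 : 1 ≤ 1 / γ ^ 2 * L := by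
    rw [one_div_mul_eq_div, le_div_iff₀ (by positivity)]
    have := Real.log_two_gt_d9
    nlinarith
  refine ⟨⟨⌈2 * (1 / γ ^ 2 * L)⌉₊, Nat.le_ceil _, ?_⟩, fun N hN2 hN3 δ S _ _ hS => ⟨?_, ?_, ?_⟩⟩
  · have := Nat.ceil_lt_add_one (by positivity : 0 ≤ 2 * (1 / γ ^ 2 * L))
    linarith
  · have hs : Real.sqrt L / γ ≤ Real.sqrt N := by
      refine Real.le_sqrt_of_sq_le ?_
      rw [div_pow, Real.sq_sqrt hL0.le, div_eq_mul_one_div, mul_comm]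
      linarith
    calc _ = 3 * (k : ℝ) ^ (5 / 2 : ℝ) * (Real.sqrt L / γ) * S := by ring
      _ ≤ _ := by gcongr
  · have hs : Real.sqrt N ≤ 2 * (Real.sqrt L / γ) := by
      refine Real.sqrt_le_iff.2 ⟨by positivity, ?_⟩
      rw [mul_pow, div_pow, Real.sq_sqrt hL0.le, div_eq_mul_one_div, mul_comm L]
      linarith
    calc _ ≤ 3 * (k : ℝ) ^ (5 / 2 : ℝ) * (2 * (Real.sqrt L / γ)) * S := by gcongr
      _ = _ := by ring
  · refine (OnlineBoosting.mbbmGuarantee hk h0 h1 N δ hS.le).mono fun T => ?_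
    gcongr
    exact OnlineBoosting.exp_neg_mul_le_of_log_le (by linarith) h0 hε hN2
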